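/- Let $p$ be an odd prime and $n\ge 1$, let $K$ be a field of characteristic zero containing a primitive $p^n$-th root of unity, and let $L/K$ be a cyclic Galois extension of degree $p^n$ with group $G=\langle\sigma\rangle$. Let $N=\langle\eta\rangle$ be a cyclic group of order $p^n$, and let $\delta$ be the $(p-1)$-st power of a generator of the cyclic group $\mathrm{Aut}(N)$. For $0\le r<p^{n-1}$ let $\beta_r:G\to \mathrm{Hol}(N)=\rho(N)\rtimes\mathrm{Aut}(N)\subseteq\mathrm{Perm}(N)$ be the homomorphism with $\beta_r(\sigma)=(\rho(\eta),\delta^r)$, i.e. $\beta_r(\sigma)$ is the permutation $x\mapsto\delta^r(x)\eta^{-1}$ of $N$. The map $b_r:G\to N$, $g\mapsto\beta_r(g)[1_N]$, is a bijection; let $\alpha_r:N\hookrightarrow\mathrm{Perm}(G)$ be the embedding corresponding to $\beta_r$ under Byott's translation, $\alpha_r(x)=b_r^{-1}\circ\lambda_N(x)\circ b_r$, where $\lambda_N(x)$ is left multiplication by $x$. The regular subgroup $\alpha_r(N)$ is normalized by the left translations $\lambda(g)$, $g\in G$. Let $$H_r=L[\alpha_r(N)]^G$$ be the $K$-algebra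 of fixed points of the group algebra $L[\alpha_r(N)]$ under the simultaneous action of $G$ on $L$ by Galois automorphisms and on $\alpha_r(N)$ by $g*\pi=\lambda(g)\pi\lambda(g)^{-1}$. For $0\le m\le n$ let $K_m=L^{\langle\sigma^{p^m}\rangle}$, the unique subfield of $L$ containing $K$ with $[K_m:K]=p^m$. Let $v_p(r)$ denote the $p$-adic valuation of $r$ if $r\neq 0$, and put $v_p(0)=n-1$. Then for every $0\le r<p^{n-1}$ there is an isomorphism of $K$-algebras $$H_r\;\cong\; K^{\,p^{1+v_p(r)}}\times\prod_{m=1}^{\,n-1-v_p(r)}\left(K_m\right)^{p^{v_p(r)}(p-1)} .$$ -/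

import Mathlib

open scoped MonoidAlgebra

noncomputable section

namespace CyclicHopfGalois

/-! ### Regular representations and the holomorph -/

/-- The left regular embedding `lam G : G → Perm G`, `lam G g : x ↦ g * x`. -/
def lam (G : Type*) [Group G] : G →* Equiv.Perm G := MulAction.toPermHom G G

/-- The right regular embedding `rho N : N → Perm N`, `rho N y : x ↦ x * y⁻¹`. -/
def rho (N : Type*) [Group N] : N →* Equiv.Perm N where
  toFun y := Equiv.mulRight y⁻¹
  map_one' := by ext x; simp
  map_mul' a b := by ext x; simp [mul_assoc]

/-- The holomorph of `N`: the normalizer of the image of the left regular embedding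
in `Perm N`. -/
def Hol (N : Type*) [Group N] : Subgroup (Equiv.Perm N) :=
  Subgroup.normalizer ((lam N).range : Set (Equiv.Perm N))

theorem mem_Hol_of {N : Type*} [Group N] (f : Equiv.Perm N) (ψ : N ≃* N)
    (h : ∀ x, f * lam N x * f⁻¹ = lam N (ψ x)) : f ∈ Hol N := by
  rw [Hol, Subgroup.mem_normalizer_iff]
  intro π
  constructor
  · rintro ⟨x, rfl⟩
    exact ⟨ψ x, (h x).symm⟩
  · rintro ⟨x, hx⟩
    refine ⟨ψ.symm x, ?_⟩
    have h1 := h (ψ.symm x)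
    rw [ψ.apply_symm_apply, hx] at h1
    simpa using h1

theorem rho_mem_Hol {N : Type*} [Group N] (y : N) : rho N y ∈ Hol N := by
  refine mem_Hol_of _ (MulEquiv.refl N) fun x => ?_
  ext z
  simp [rho, lam, Equiv.Perm.inv_def, mul_assoc]

theorem aut_mem_Hol {N : Type*} [Group N] (φ : MulAut N) : MulAut.toPerm N φ ∈ Hol N := by
  refine mem_Hol_of _ φ fun x => ?_
  rw [mul_inv_eq_iff_eq_mul]
  ext z
  exact map_mul φ x z

/-- The element `(rho y, φ)` of `Hol N = rho(N) ⋊ Aut N`, that is, the permutation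
`x ↦ φ x * y⁻¹` of `N`. -/
def holElt {N : Type*} [Group N] (y : N) (φ : MulAut N) : Hol N :=
  ⟨rho N y, rho_mem_Hol y⟩ * ⟨MulAut.toPerm N φ, aut_mem_Hol φ⟩

theorem holElt_apply {N : Type*} [Group N] (y : N) (φ : MulAut N) (x : N) :
    (holElt y φ : Equiv.Perm N) x = φ x * y⁻¹ := rfl

/-! ### Byott's translation -/

/-- The bijection `G → N`, `g ↦ β g 1`, attached to a regular embedding `β : G → Hol N`. -/
def orbitEquiv {G N : Type*} [Group G] [Group N] (β : G →* Hol N)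
    (hβ : Function.Bijective fun g : G => (β g : Equiv.Perm N) 1) : G ≃ N :=
  Equiv.ofBijective _ hβ

/-- Byott's translation: the embedding `α : N → Perm G` corresponding to a regular embedding
`β : G → Hol N`. With `b : G ≃ N`, `b g = β g 1`, it is `α x = b⁻¹ ∘ lam x ∘ b`. -/
def translate {G N : Type*} [Group G] [Group N] (β : G →* Hol N)
    (hβ : Function.Bijective fun g : G => (β g : Equiv.Perm N) 1) : N →* Equiv.Perm G :=
  ((orbitEquiv β hβ).symm.permCongrHom : Equiv.Perm N →* Equiv.Perm G).comp (lam N)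

theorem translate_stable {G N : Type*} [Group G] [Group N] (β : G →* Hol N)
    (hβ : Function.Bijective fun g : G => (β g : Equiv.Perm N) 1) (g : G) :
    lam G g ∈ Subgroup.normalizer ((translate β hβ).range : Set (Equiv.Perm G)) := by
  have h1 : (translate β hβ).range = (lam N).range.map
      ((orbitEquiv β hβ).symm.permCongrHom : Equiv.Perm N →* Equiv.Perm G) := by
    rw [translate, MonoidHom.range_comp]
  have h2 : lam G g = (orbitEquiv β hβ).symm.permCongrHom (β g : Equiv.Perm N) := by
    ext h
    apply (orbitEquiv β hβ).injective
    simp [lam, Equiv.permCongrHom, Equiv.permCongr_apply, orbitEquiv]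
  have h3 := Subgroup.map_equiv_normalizer_eq (lam N).range (orbitEquiv β hβ).symm.permCongrHom
  rw [h1, h2]
  exact h3.le ⟨_, (β g).2, rfl⟩

/-! ### The Hopf algebra attached to a `G`-stable subgroup of `Perm G` -/

/-- Let the group `Gal(L/K)` act on a group `M` by automorphisms through `φ`. This is the
`K`-algebra automorphism `∑ c_m m ↦ ∑ g(c_m) φ_g(m)` of `L[M]` given by `g`. -/
def galAct (K L : Type*) [Field K] [Field L] [Algebra K L] {M : Type*} [Group M]
    (φ : Gal(L/K) →* MulAut M) (g : Gal(L/K)) : L[M] →ₐ[K] L[M] :=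
  (MonoidAlgebra.mapDomainAlgHom K L (φ g : M →* M)).comp
    (MonoidAlgebra.mapAlgHom M (g : L →ₐ[K] L))

/-- The `K`-algebra `L[M]^G` of fixed points of `G = Gal(L/K)` acting on the group algebra
`L[M]` through its Galois action on `L` and through `φ` on `M`. -/
def fixedPoints (K L : Type*) [Field K] [Field L] [Algebra K L] {M : Type*} [Group M]
    (φ : Gal(L/K) →* MulAut M) : Subalgebra K L[M] :=
  ⨅ g : Gal(L/K), AlgHom.equalizer (galAct K L φ g) (AlgHom.id K L[M])

/-- The conjugation action `g ∗ π = lam g * π * (lam g)⁻¹` of `G` on a subgroup `M` of `Perm G`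
that is normalized by `lam G`. -/
def conjAct {G : Type*} [Group G] (M : Subgroup (Equiv.Perm G))
    (hM : ∀ g, lam G g ∈ Subgroup.normalizer (M : Set (Equiv.Perm G))) : G →* MulAut M :=
  M.normalizerMonoidHom.comp ((lam G).codRestrict _ hM)

/-- The algebra `L[M]^G` of Greither and Pareigis, for `G = Gal(L/K)` and a subgroup `M` of
`Perm G` normalized by `lam G`. -/
def hopfAlg (K L : Type*) [Field K] [Field L] [Algebra K L]
    (M : Subgroup (Equiv.Perm Gal(L/K)))
    (hM : ∀ g, lam Gal(L/K) g ∈ Subgroup.normalizer (M : Set (Equiv.Perm Gal(L/K)))) :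
    Subalgebra K L[M] :=
  fixedPoints K L (conjAct M hM)

/-! ### The embeddings for cyclic groups of odd prime power order -/

theorem dvd_geom_sum_iff {p : ℕ} (hp : p.Prime) (hp2 : p ≠ 2) (n k : ℕ) (d : ℤ)
    (hd : (p : ℤ) ∣ d - 1) :
    ((p ^ n : ℕ) : ℤ) ∣ ∑ i ∈ Finset.range k, d ^ i ↔ p ^ n ∣ k := by
  by_cases h1 : d = 1
  · subst h1
    simp only [one_pow, Finset.sum_const, Finset.card_range, nsmul_eq_mul, mul_one]
    exact Int.natCast_dvd_natCast
  · have hpd : ¬ (p : ℤ) ∣ d := fun h => by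
      have h3 : (p : ℤ) ∣ 1 := by simpa using dvd_sub h hd
      have h4 : p ∣ 1 := by exact_mod_cast h3
      exact hp.one_lt.ne' (Nat.dvd_one.mp h4)
    have h2 := Int.emultiplicity_pow_sub_pow hp (hp.odd_of_ne_two hp2) hd hpd k
    rw [one_pow, ← geom_sum_mul, emultiplicity_mul (Nat.prime_iff_prime_int.mp hp),
      add_comm] at h2
    have hfin : FiniteMultiplicity (p : ℤ) (d - 1) := by
      rw [Int.finiteMultiplicity_iff]
      exact ⟨by simpa using hp.one_lt.ne', sub_ne_zero.mpr h1⟩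
    have h3 := (WithTop.add_left_inj (finiteMultiplicity_iff_emultiplicity_ne_top.mp hfin)).mp h2
    rw [Nat.cast_pow, pow_dvd_iff_le_emultiplicity, h3, ← pow_dvd_iff_le_emultiplicity]

theorem aut_pow_gen {N : Type*} [Group N] {p n : ℕ} (hp : p.Prime) (hn : 1 ≤ n) {η : N}
    (hη : ∀ x : N, x ∈ Subgroup.zpowers η) (hN : Nat.card N = p ^ n) (θ : MulAut N) (r : ℕ) :
    ∃ d : ℤ, (p : ℤ) ∣ d - 1 ∧ ((θ ^ (p - 1)) ^ r) η = η ^ d := by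
  obtain ⟨t, ht⟩ := Subgroup.mem_zpowers_iff.mp (hη (θ η))
  have hord : orderOf η = p ^ n := by rw [orderOf_eq_card_of_forall_mem_zpowers hη, hN]
  have hpow : ∀ j : ℕ, (θ ^ j) η = η ^ (t ^ j) := by
    intro j
    induction j with
    | zero => simp
    | succ j ih =>
      rw [pow_succ', MulAut.mul_apply, ih, map_zpow, ← ht, ← zpow_mul, pow_succ']
  have hpt : ¬ (p : ℤ) ∣ t := by
    rintro ⟨u, rfl⟩
    have h1 : (θ η) ^ (p ^ (n - 1)) = 1 := by
      rw [← ht, ← zpow_natCast, ← zpow_mul]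
      have h2 : (p : ℤ) * u * ((p ^ (n - 1) : ℕ) : ℤ) = ((p ^ n : ℕ) : ℤ) * u := by
        obtain ⟨m, rfl⟩ := Nat.exists_eq_add_of_le' hn
        push_cast
        ring
      rw [h2, zpow_mul, zpow_natCast, ← hord, pow_orderOf_eq_one, one_zpow]
    rw [← map_pow, map_eq_one_iff θ θ.injective] at h1
    have h3 := orderOf_dvd_of_pow_eq_one h1
    rw [hord, Nat.pow_dvd_pow_iff_le_right hp.one_lt] at h3
    omega
  refine ⟨t ^ ((p - 1) * r), ?_, by rw [← pow_mul, hpow]⟩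
  have hc : IsCoprime t (p : ℤ) :=
    ((Nat.prime_iff_prime_int.mp hp).coprime_iff_not_dvd.mpr hpt).symm
  have h4 : t ^ (p - 1) ≡ 1 [ZMOD p] := Int.ModEq.pow_card_sub_one_eq_one hp hc
  have h5 := (h4.pow r).symm.dvd
  rwa [one_pow, ← pow_mul] at h5

theorem holElt_pow_apply {N : Type*} [Group N] (η : N) (φ : MulAut N) (d : ℤ)
    (hd : φ η = η ^ d) (k : ℕ) (a : ℤ) :
    ((holElt η φ ^ k : Hol N) : Equiv.Perm N) (η ^ a) =
      η ^ (d ^ k * a - ∑ i ∈ Finset.range k, d ^ i) := by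
  induction k with
  | zero => simp
  | succ k ih =>
    have h1 : ((holElt η φ ^ (k + 1) : Hol N) : Equiv.Perm N) (η ^ a) =
        (holElt η φ : Equiv.Perm N) (((holElt η φ ^ k : Hol N) : Equiv.Perm N) (η ^ a)) := by
      rw [pow_succ']; rfl
    rw [h1, ih, holElt_apply, map_zpow, hd, ← zpow_mul, ← zpow_sub_one, geom_sum_succ]
    congr 1
    ring

theorem holElt_pow_eq_one {N : Type*} [Group N] {p n : ℕ} (hp : p.Prime) (hp2 : p ≠ 2)
    (hn : 1 ≤ n) {η : N} (hη : ∀ x : N, x ∈ Subgroup.zpowers η) (hN : Nat.card N = p ^ n)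
    (θ : MulAut N) (r : ℕ) : holElt η ((θ ^ (p - 1)) ^ r) ^ (p ^ n) = 1 := by
  obtain ⟨d, hd1, hd2⟩ := aut_pow_gen hp hn hη hN θ r
  have hord : orderOf η = p ^ n := by rw [orderOf_eq_card_of_forall_mem_zpowers hη, hN]
  have hS := (dvd_geom_sum_iff hp hp2 n (p ^ n) d hd1).mpr dvd_rfl
  have hD : ((p ^ n : ℕ) : ℤ) ∣ d ^ (p ^ n) - 1 := by
    rw [← geom_sum_mul]; exact hS.mul_right _
  apply Subtype.ext
  ext x
  obtain ⟨a, rfl⟩ := Subgroup.mem_zpowers_iff.mp (hη x)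
  rw [holElt_pow_apply η _ d hd2, OneMemClass.coe_one, Equiv.Perm.one_apply,
    zpow_eq_zpow_iff_modEq, hord]
  apply Int.ModEq.symm
  rw [Int.modEq_iff_dvd]
  have h : d ^ p ^ n * a - ∑ i ∈ Finset.range (p ^ n), d ^ i - a =
      (d ^ p ^ n - 1) * a - ∑ i ∈ Finset.range (p ^ n), d ^ i := by ring
  rw [h]
  exact dvd_sub (hD.mul_right _) hS

/-- Let `G = ⟨σ⟩` and `N = ⟨η⟩` be cyclic of order `p ^ n` with `p` an odd prime, `θ` an
automorphism of `N` and `δ = θ ^ (p - 1)`. This is the homomorphism `β_r : G → Hol N` with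
`β_r σ = (rho η, δ ^ r)`. -/
def beta {G N : Type*} [Group G] [Group N] {p n : ℕ} (hp : p.Prime) (hp2 : p ≠ 2) (hn : 1 ≤ n)
    {σ : G} (hσ : ∀ g : G, g ∈ Subgroup.zpowers σ) (hG : Nat.card G = p ^ n)
    {η : N} (hη : ∀ x : N, x ∈ Subgroup.zpowers η) (hN : Nat.card N = p ^ n)
    (θ : MulAut N) (r : ℕ) : G →* Hol N :=
  monoidHomOfForallMemZpowers (g' := holElt η ((θ ^ (p - 1)) ^ r)) hσ
    (by
      rw [orderOf_eq_card_of_forall_mem_zpowers hσ, hG]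
      exact orderOf_dvd_of_pow_eq_one (holElt_pow_eq_one hp hp2 hn hη hN θ r))

theorem beta_gen {G N : Type*} [Group G] [Group N] {p n : ℕ} (hp : p.Prime) (hp2 : p ≠ 2)
    (hn : 1 ≤ n) {σ : G} (hσ : ∀ g : G, g ∈ Subgroup.zpowers σ) (hG : Nat.card G = p ^ n)
    {η : N} (hη : ∀ x : N, x ∈ Subgroup.zpowers η) (hN : Nat.card N = p ^ n)
    (θ : MulAut N) (r : ℕ) :
    beta hp hp2 hn hσ hG hη hN θ r σ = holElt η ((θ ^ (p - 1)) ^ r) :=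
  monoidHomOfForallMemZpowers_apply_gen hσ _

theorem beta_regular {G N : Type*} [Group G] [Group N] {p n : ℕ} (hp : p.Prime) (hp2 : p ≠ 2)
    (hn : 1 ≤ n) {σ : G} (hσ : ∀ g : G, g ∈ Subgroup.zpowers σ) (hG : Nat.card G = p ^ n)
    {η : N} (hη : ∀ x : N, x ∈ Subgroup.zpowers η) (hN : Nat.card N = p ^ n)
    (θ : MulAut N) (r : ℕ) :
    Function.Bijective fun g : G =>
      (beta hp hp2 hn hσ hG hη hN θ r g : Equiv.Perm N) 1 := by
  set β := beta hp hp2 hn hσ hG hη hN θ r with hβ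
  have hpos : 0 < p ^ n := pow_pos hp.pos n
  have : Finite G := Nat.finite_of_card_ne_zero (by omega)
  have : Finite N := Nat.finite_of_card_ne_zero (by omega)
  obtain ⟨d, hd1, hd2⟩ := aut_pow_gen hp hn hη hN θ r
  have hordη : orderOf η = p ^ n := by rw [orderOf_eq_card_of_forall_mem_zpowers hη, hN]
  have hordσ : orderOf σ = p ^ n := by rw [orderOf_eq_card_of_forall_mem_zpowers hσ, hG]
  have key : ∀ g : G, (β g : Equiv.Perm N) 1 = 1 → g = 1 := by
    intro g hg
    obtain ⟨k, rfl⟩ := (Submonoid.mem_powers_iff _ _).mp (mem_powers_iff_mem_zpowers.mpr (hσ g))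
    rw [map_pow, hβ, beta_gen] at hg
    have h1 := holElt_pow_apply η _ d hd2 k 0
    rw [zpow_zero, hg, mul_zero, zero_sub, zpow_neg, eq_comm, inv_eq_one,
      ← orderOf_dvd_iff_zpow_eq_one, hordη, dvd_geom_sum_iff hp hp2 n k d hd1] at h1
    rw [← orderOf_dvd_iff_pow_eq_one, hordσ]
    exact h1
  refine (Nat.bijective_iff_injective_and_card _).mpr ⟨?_, by rw [hG, hN]⟩
  intro g h hgh
  have h1 : (β (h⁻¹ * g) : Equiv.Perm N) 1 = 1 := by
    have h2 : (β g : Equiv.Perm N) 1 = (β h : Equiv.Perm N) 1 := hgh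
    rw [map_mul, map_inv, Subgroup.coe_mul, Equiv.Perm.mul_apply, h2, Subgroup.coe_inv,
      Equiv.Perm.inv_def, Equiv.symm_apply_apply]
  exact (inv_mul_eq_one.mp (key _ h1)).symm

/-- The embedding `α_r : N → Perm G` corresponding to `β_r` under Byott's translation. -/
def alpha {G N : Type*} [Group G] [Group N] {p n : ℕ} (hp : p.Prime) (hp2 : p ≠ 2) (hn : 1 ≤ n)
    {σ : G} (hσ : ∀ g : G, g ∈ Subgroup.zpowers σ) (hG : Nat.card G = p ^ n)
    {η : N} (hη : ∀ x : N, x ∈ Subgroup.zpowers η) (hN : Nat.card N = p ^ n)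
    (θ : MulAut N) (r : ℕ) : N →* Equiv.Perm G :=
  translate (beta hp hp2 hn hσ hG hη hN θ r) (beta_regular hp hp2 hn hσ hG hη hN θ r)

/-- The algebra `H_r = L[α_r(N)]^G`, where `G = Gal(L/K) = ⟨σ⟩`. -/
abbrev hopfAlgCyclic (K L : Type*) [Field K] [Field L] [Algebra K L] {N : Type*} [Group N]
    {p n : ℕ} (hp : p.Prime) (hp2 : p ≠ 2) (hn : 1 ≤ n)
    {σ : Gal(L/K)} (hσ : ∀ g : Gal(L/K), g ∈ Subgroup.zpowers σ)
    (hG : Nat.card Gal(L/K) = p ^ n)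
    {η : N} (hη : ∀ x : N, x ∈ Subgroup.zpowers η) (hN : Nat.card N = p ^ n)
    (θ : MulAut N) (r : ℕ) : Subalgebra K L[(alpha hp hp2 hn hσ hG hη hN θ r).range] :=
  hopfAlg K L (alpha hp hp2 hn hσ hG hη hN θ r).range
    (translate_stable (beta hp hp2 hn hσ hG hη hN θ r) (beta_regular hp hp2 hn hσ hG hη hN θ r))

/-! ### The tower of intermediate fields and the valuation of `r` -/

/-- The field `K_m`: the fixed field of `⟨σ ^ (p ^ m)⟩`. If `Gal(L/K) = ⟨σ⟩` has order `p ^ n`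
and `m ≤ n`, it is the unique intermediate field of degree `p ^ m` over `K`. -/
abbrev tower {K L : Type*} [Field K] [Field L] [Algebra K L] (p : ℕ) (σ : Gal(L/K)) (m : ℕ) :
    IntermediateField K L :=
  IntermediateField.fixedField (Subgroup.zpowers (σ ^ (p ^ m)))

theorem finrank_tower {K L : Type*} [Field K] [Field L] [Algebra K L] [FiniteDimensional K L]
    [IsGalois K L] {p n : ℕ} (hp : p.Prime) (hL : Module.finrank K L = p ^ n) {σ : Gal(L/K)}
    (hσ : ∀ g : Gal(L/K), g ∈ Subgroup.zpowers σ) {m : ℕ} (hm : m ≤ n) :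
    Module.finrank K (tower p σ m) = p ^ m := by
  have hord : orderOf σ = p ^ n := by
    rw [orderOf_eq_card_of_forall_mem_zpowers hσ, IsGalois.card_aut_eq_finrank, hL]
  have h1 : Module.finrank (tower p σ m) L = p ^ (n - m) := by
    rw [IntermediateField.finrank_fixedField_eq_card, Nat.card_zpowers,
      orderOf_pow_of_dvd (pow_pos hp.pos m).ne' (hord ▸ pow_dvd_pow p hm), hord,
      Nat.pow_div hm hp.pos]
  have h2 := Module.finrank_mul_finrank K (tower p σ m) L
  rw [h1, hL] at h2
  refine Nat.eq_of_mul_eq_mul_right (pow_pos hp.pos (n - m)) ?_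
  rw [h2, ← pow_add, Nat.add_sub_cancel' hm]

/-- The `p`-adic valuation of an index `0 ≤ r < p ^ (n - 1)`; the index `0`, which plays the role
of `p ^ (n - 1)`, has valuation `n - 1`. -/
def val (p n r : ℕ) : ℕ := if r = 0 then n - 1 else padicValNat p r

end CyclicHopfGalois

end

namespace CyclicHopfGalois

/-! Conjugation by `λ(σ)` on `M = α_r(N)` corresponds to `δ^r` on `N`: the translation part of
`β_r(σ)` acts by right multiplication and commutes with `λ_N`. Hence `σ` acts on `M` by `y ↦ y ^ d`
for some integer `d ≡ 1` mod `p`.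

Since `K` contains the `p^n`-th roots of unity, all characters of `M` are `K`-valued, and the
Fourier transform turns `L[M]` into the functions from characters to `L` (`fourier_bijective`).
Fixed points become `G`-equivariant functions (`nonempty_fixedPoints_algEquiv`), and these form the
product, over the orbits of characters, of the fixed fields of the stabilizers
(`nonempty_equivariantFunctions_algEquiv`).

It remains to find stabilizers and count orbits. The automorphism `δ^r` has order `p^(n-1-v)` with
`v = v_p(r)`, so by lifting the exponent `d - 1` has valuation `1 + v` up to precision `p^n`
(`pow_dvd_pow_sub_one_iff_of_generator`). A character of order `p^s` therefore has stabilizer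
`⟨σ^(p^m)⟩` with `m = max(s - 1 - v, 0)`, which contributes the field `K_m`. There are `p^(1+v)`
fixed characters, and for `m ≥ 1` the `p^(v+m)(p-1)` characters of order `p^(1+v+m)` fall into
`p^v(p-1)` orbits of length `p^m`. -/

/-! ### Equivariant functions and products of fixed fields -/

/-- The `K`-algebra of `Gal(L/K)`-equivariant functions on a `Gal(L/K)`-set with values in `L`. -/
def equivariantFunctions (K L X : Type*) [Field K] [Field L] [Algebra K L]
    [MulAction Gal(L/K) X] : Subalgebra K (X → L) where
  carrier := {f | ∀ (g : Gal(L/K)) (x : X), f (g • x) = g (f x)}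
  mul_mem' := fun ha hb g x => by simp [ha g x, hb g x]
  add_mem' := fun ha hb g x => by simp [ha g x, hb g x]
  algebraMap_mem' := fun c g x => by simp

theorem mem_equivariantFunctions {K L X : Type*} [Field K] [Field L] [Algebra K L]
    [MulAction Gal(L/K) X] {f : X → L} :
    f ∈ equivariantFunctions K L X ↔ ∀ (g : Gal(L/K)) (x : X), f (g • x) = g (f x) := Iff.rfl

/-- An equivariant function is determined by its values at representatives of the orbits, and
the value at a representative is an arbitrary element fixed by its stabilizer. -/
theorem nonempty_equivariantFunctions_algEquiv (K L X : Type*) [Field K] [Field L] [Algebra K L]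
    [MulAction Gal(L/K) X] (F : MulAction.orbitRel.Quotient Gal(L/K) X → IntermediateField K L)
    (hF : ∀ ω, F ω = IntermediateField.fixedField
      (MulAction.stabilizer Gal(L/K) (Quotient.out ω))) :
    Nonempty (equivariantFunctions K L X ≃ₐ[K] (∀ ω, F ω)) := by
  have hmem : ∀ (f : equivariantFunctions K L X) ω, (f : X → L) (Quotient.out ω) ∈ F ω := by
    intro f ω
    rw [hF, IntermediateField.mem_fixedField_iff]
    intro g hg
    rw [← f.2 g, MulAction.mem_stabilizer_iff.mp hg]
  let Φ : equivariantFunctions K L X →ₐ[K] (∀ ω, F ω) := AlgHom.pi fun ω =>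
    ((Pi.evalAlgHom K (fun _ : X => L) (Quotient.out ω)).comp
      (equivariantFunctions K L X).val).codRestrict (F ω).toSubalgebra fun f => hmem f ω
  have hΦ : ∀ f ω, ((Φ f ω : F ω) : L) = (f : X → L) (Quotient.out ω) := fun _ _ => rfl
  let := MulAction.orbitRel Gal(L/K) X
  have hout : ∀ x : X, ∃ g : Gal(L/K),
      g • (Quotient.out (⟦x⟧ : MulAction.orbitRel.Quotient Gal(L/K) X)) = x := fun x =>
    MulAction.orbitRel_apply.mp (Setoid.symm (Quotient.mk_out x))
  refine ⟨AlgEquiv.ofBijective Φ ⟨?_, ?_⟩⟩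
  · intro f f' h
    ext x
    obtain ⟨g, hg⟩ := hout x
    rw [← hg, f.2, f'.2, ← hΦ, ← hΦ, h]
  · intro a
    choose s hs using hout
    -- Two elements carrying the representative to `x` differ by its stabilizer, which fixes `a ω`;
    -- so the choice of `s x` does not matter.
    have key : ∀ (x : X) (ω : MulAction.orbitRel.Quotient Gal(L/K) X) (g : Gal(L/K)),
        g • Quotient.out ω = x → s x (a ⟦x⟧ : F ⟦x⟧) = g (a ω : F ω) := by
      intro x ω g hg
      have h1 : (⟦x⟧ : MulAction.orbitRel.Quotient Gal(L/K) X) = ω := by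
        rw [← hg, MulAction.orbitRel.Quotient.quotient_smul_eq, Quotient.out_eq]
      subst h1
      have h2 : g⁻¹ * s x ∈ MulAction.stabilizer Gal(L/K)
          (Quotient.out (⟦x⟧ : MulAction.orbitRel.Quotient Gal(L/K) X)) := by
        rw [MulAction.mem_stabilizer_iff, mul_smul, hs, ← hg, inv_smul_smul, hg]
      have h3 := (hF ⟦x⟧).le (a ⟦x⟧).2
      have h4 := congrArg g ((IntermediateField.mem_fixedField_iff _ _).mp h3 _ h2)
      rwa [← AlgEquiv.mul_apply, mul_inv_cancel_left] at h4
    refine ⟨⟨fun x => s x (a ⟦x⟧ : F ⟦x⟧), fun g x => ?_⟩, ?_⟩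
    · change s (g • x) (a ⟦g • x⟧ : F ⟦g • x⟧) = g (s x (a ⟦x⟧ : F ⟦x⟧))
      rw [key (g • x) ⟦x⟧ (g * s x) (by rw [mul_smul, hs]), AlgEquiv.mul_apply]
    · ext ω
      rw [hΦ]
      exact key _ ω 1 (one_smul _ _)

/-- Sorting the factors of a product of fields `F (m ω)` according to the value of `m`. -/
theorem nonempty_pi_algEquiv_sorted {K L Ω : Type*} [Field K] [Field L] [Algebra K L] [Finite Ω]
    (F : ℕ → IntermediateField K L) (hF : F 0 = ⊥) (m : Ω → ℕ) {T A B : ℕ} (hm : ∀ ω, m ω ≤ T)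
    (hA : Nat.card {ω // m ω = 0} = A)
    (hB : ∀ j, 1 ≤ j → j ≤ T → Nat.card {ω // m ω = j} = B) :
    Nonempty ((∀ ω, F (m ω)) ≃ₐ[K]
      ((Fin A → K) × ((j : Finset.Icc 1 T) → (Fin B → F (j : ℕ))))) := by
  let e₀ : {ω // m ω = 0} ≃ Fin A := Finite.equivFinOfCardEq hA
  let e : ∀ j : Finset.Icc 1 T, {ω // m ω = (j : ℕ)} ≃ Fin B := fun j =>
    Finite.equivFinOfCardEq (hB j (Finset.mem_Icc.mp j.2).1 (Finset.mem_Icc.mp j.2).2)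
  let c₀ : ∀ x : {ω // m ω = 0}, F (m x) ≃ₐ[K] K := fun x =>
    (IntermediateField.equivOfEq ((congrArg F x.2).trans hF)).trans
      (IntermediateField.botEquiv K L)
  let c : ∀ (j : ℕ) (x : {ω // m ω = j}), F (m x) ≃ₐ[K] F j := fun j x =>
    IntermediateField.equivOfEq (congrArg F x.2)
  let Φ : (∀ ω, F (m ω)) →ₐ[K]
      ((Fin A → K) × ((j : Finset.Icc 1 T) → (Fin B → F (j : ℕ)))) :=
    AlgHom.prod
      (AlgHom.pi fun i => (c₀ (e₀.symm i)).toAlgHom.comp (Pi.evalAlgHom K (fun ω => F (m ω)) _))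
      (AlgHom.pi fun j => AlgHom.pi fun i =>
        (c j ((e j).symm i)).toAlgHom.comp (Pi.evalAlgHom K (fun ω => F (m ω)) _))
  have hΦ₀ : ∀ a x, (Φ a).1 (e₀ x) = c₀ x (a x) := by
    intro a x
    change c₀ (e₀.symm (e₀ x)) (a (e₀.symm (e₀ x)).1) = _
    rw [Equiv.symm_apply_apply]
  have hΦ : ∀ a j x, (Φ a).2 j (e j x) = c j x (a x) := by
    intro a j x
    change c j ((e j).symm (e j x)) (a ((e j).symm (e j x)).1) = _
    rw [Equiv.symm_apply_apply]
  have hIcc : ∀ ω, m ω ≠ 0 → m ω ∈ Finset.Icc 1 T := fun ω h =>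
    Finset.mem_Icc.mpr ⟨Nat.one_le_iff_ne_zero.mpr h, hm ω⟩
  refine ⟨AlgEquiv.ofBijective Φ ⟨?_, ?_⟩⟩
  · intro a a' h
    funext ω
    by_cases h0 : m ω = 0
    · apply (c₀ ⟨ω, h0⟩).injective
      rw [← hΦ₀ a ⟨ω, h0⟩, ← hΦ₀ a' ⟨ω, h0⟩, h]
    · apply (c _ ⟨ω, rfl⟩).injective
      rw [← hΦ a ⟨_, hIcc ω h0⟩ ⟨ω, rfl⟩, ← hΦ a' ⟨_, hIcc ω h0⟩ ⟨ω, rfl⟩, h]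
  · intro b
    let a : ∀ ω, F (m ω) := fun ω =>
      if h0 : m ω = 0 then (c₀ ⟨ω, h0⟩).symm (b.1 (e₀ ⟨ω, h0⟩))
      else (c _ ⟨ω, rfl⟩).symm (b.2 ⟨_, hIcc ω h0⟩ (e ⟨_, hIcc ω h0⟩ ⟨ω, rfl⟩))
    refine ⟨a, Prod.ext ?_ ?_⟩
    · funext i
      obtain ⟨⟨ω, h0⟩, rfl⟩ := e₀.surjective i
      rw [hΦ₀]
      simp only [a, dif_pos h0, AlgEquiv.apply_symm_apply]
    · funext j i
      obtain ⟨⟨ω, h⟩, rfl⟩ := (e j).surjective i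
      obtain ⟨j, hj⟩ := j
      dsimp only at h
      subst h
      have h0 : m ω ≠ 0 := Nat.one_le_iff_ne_zero.mp (Finset.mem_Icc.mp hj).1
      rw [hΦ]
      simp only [a, dif_neg h0, AlgEquiv.apply_symm_apply]

/-! ### Characters and the Fourier transform -/

/-- The action of `G` on the characters of a group on which it acts by automorphisms. -/
abbrev characterAction {G M A : Type*} [Group G] [Group M] [Monoid A] (φ : G →* MulAut M) :
    MulAction G (M →* A) where
  smul g χ := χ.comp (φ g⁻¹ : M →* M)
  one_smul χ := by
    ext x
    change χ (φ 1⁻¹ x) = χ x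
    simp
  mul_smul g h χ := by
    ext x
    change χ (φ (g * h)⁻¹ x) = χ (φ h⁻¹ (φ g⁻¹ x))
    simp

/-- The Fourier transform `∑ c_m m ↦ (χ ↦ ∑ c_m χ(m))` of the group algebra `L[M]`, for
characters with values in `K`. -/
noncomputable def fourier (K L M : Type*) [Field K] [Field L] [Algebra K L] [Group M] :
    L[M] →ₐ[L] ((M →* Kˣ) → L) :=
  AlgHom.pi fun χ => MonoidAlgebra.lift L L M
    ((algebraMap K L : K →* L).comp ((Units.coeHom K).comp χ))

theorem fourier_single {K L M : Type*} [Field K] [Field L] [Algebra K L] [Group M]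
    (m : M) (c : L) (χ : M →* Kˣ) :
    fourier K L M (MonoidAlgebra.single m c) χ = c * algebraMap K L (χ m) := by
  simp [fourier]

/-- Characters separate the points of `M`, so evaluations at distinct elements are distinct
homomorphisms from the dual group to `L`. Dedekind's independence of characters gives injectivity,
and equality of dimensions gives surjectivity. -/
theorem fourier_bijective (K L M : Type*) [Field K] [Field L] [Algebra K L] [CommGroup M]
    [Finite M] [HasEnoughRootsOfUnity K (Monoid.exponent M)] :
    Function.Bijective (fourier K L M) := by
  have := Fintype.ofFinite M
  have := Fintype.ofFinite (M →* Kˣ)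
  let ev : M → ((M →* Kˣ) →* L) := fun m =>
    (algebraMap K L : K →* L).comp ((Units.coeHom K).comp (MonoidHom.eval m))
  have hev : Function.Injective ev := by
    intro m m' h
    refine (CommGroup.forall_apply_eq_apply_iff (M := K) M).mp fun χ => Units.ext ?_
    exact (algebraMap K L).injective (DFunLike.congr_fun h χ)
  have hli := (linearIndependent_monoidHom (M →* Kˣ) L).comp ev hev
  have hinj : Function.Injective (fourier K L M) := by
    rw [LinearIndependent] at hli
    have h : ∀ a, fourier K L M a =
        Finsupp.linearCombination L ((fun f : (M →* Kˣ) →* L => (f : (M →* Kˣ) → L)) ∘ ev)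
          (MonoidAlgebra.coeff a) := by
      intro a
      induction a using MonoidAlgebra.induction_linear with
      | zero => simp
      | add a b ha hb => simp [ha, hb]
      | single m c =>
        funext χ
        rw [fourier_single]
        simp [ev]
    intro a b hab
    rw [h, h] at hab
    exact MonoidAlgebra.coeff_injective (hli hab)
  refine ⟨hinj, ?_⟩
  have hcard : Module.finrank L L[M] = Module.finrank L ((M →* Kˣ) → L) := by
    rw [Module.finrank_fintype_fun_eq_card, ← Nat.card_eq_fintype_card,
      CommGroup.card_monoidHom_of_hasEnoughRootsOfUnity M K,
      (MonoidAlgebra.coeffLinearEquiv L).finrank_eq]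
    simp
  have : Module.Finite L L[M] := Module.Finite.equiv (MonoidAlgebra.coeffLinearEquiv L).symm
  exact (LinearMap.injective_iff_surjective_of_finrank_eq_finrank (f := (fourier K L M).toLinearMap)
    hcard).mp hinj

/-- Because `χ` takes values in `K`, the automorphism `g` fixes `χ(m)` and can be pulled out of the
sum. -/
theorem fourier_galAct {K L M : Type*} [Field K] [Field L] [Algebra K L] [Group M]
    (φ : Gal(L/K) →* MulAut M) (g : Gal(L/K)) (a : L[M]) (χ : M →* Kˣ) :
    fourier K L M (galAct K L φ g a) χ = g (fourier K L M a (χ.comp (φ g : M →* M))) := by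
  induction a using MonoidAlgebra.induction_linear with
  | zero => simp
  | add a b ha hb => simp [ha, hb]
  | single m c =>
    rw [fourier_single]
    simp [galAct, fourier_single]

theorem mem_fixedPoints {K L M : Type*} [Field K] [Field L] [Algebra K L] [Group M]
    {φ : Gal(L/K) →* MulAut M} {a : L[M]} :
    a ∈ fixedPoints K L φ ↔ ∀ g, galAct K L φ g a = a := by
  simp [fixedPoints, Algebra.mem_iInf, AlgHom.mem_equalizer]

/-- The Fourier transform identifies `L[M]^G` with the equivariant functions on the characters. -/
theorem nonempty_fixedPoints_algEquiv (K L M : Type*) [Field K] [Field L] [Algebra K L]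
    [CommGroup M] [Finite M] [HasEnoughRootsOfUnity K (Monoid.exponent M)]
    (φ : Gal(L/K) →* MulAut M) :
    letI := characterAction (A := Kˣ) φ
    Nonempty (fixedPoints K L φ ≃ₐ[K] equivariantFunctions K L (M →* Kˣ)) := by
  let := characterAction (A := Kˣ) φ
  have hbij := fourier_bijective K L M
  have hsmul : ∀ (g : Gal(L/K)) (χ : M →* Kˣ), (g • χ).comp (φ g : M →* M) = χ := by
    intro g χ
    ext x
    change ((χ (φ g⁻¹ (φ g x)) : Kˣ) : K) = χ x
    simp
  let e : L[M] ≃ₐ[K] ((M →* Kˣ) → L) :=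
    AlgEquiv.ofBijective ((fourier K L M).restrictScalars K) hbij
  have he : ∀ a, e a = fourier K L M a := fun _ => rfl
  have hmem : ∀ a, a ∈ fixedPoints K L φ ↔ e a ∈ equivariantFunctions K L (M →* Kˣ) := by
    intro a
    rw [mem_fixedPoints, mem_equivariantFunctions]
    refine forall_congr' fun g => ?_
    rw [← hbij.1.eq_iff, funext_iff]
    -- Every character has the form `g • χ`; testing there removes the twist by `φ g`.
    refine (MulAction.surjective g).forall.trans (forall_congr' fun χ => ?_)
    rw [fourier_galAct, hsmul, he, eq_comm]
  have hmap : (fixedPoints K L φ).map (e : L[M] →ₐ[K] ((M →* Kˣ) → L)) =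
      equivariantFunctions K L (M →* Kˣ) := by
    ext f
    obtain ⟨a, rfl⟩ := e.surjective f
    rw [← hmem]
    constructor
    · rintro ⟨b, hb, hba⟩
      rwa [← e.injective hba]
    · exact fun ha => ⟨a, ha, rfl⟩
  exact ⟨((fixedPoints K L φ).equivMapOfInjective _ e.injective).trans
    (Subalgebra.equivOfEq _ _ hmap)⟩

/-! ### Counting elements by order in a cyclic `p`-group -/

theorem orderOf_eq_pow_padicValNat {X : Type*} [Group X] {p n : ℕ} (hp : p.Prime) (hX : Nat.card X = p ^ n) (x : X) :
    orderOf x = p ^ padicValNat p (orderOf x) ∧ padicValNat p (orderOf x) ≤ n := by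
  obtain ⟨s, hs, h⟩ := (Nat.dvd_prime_pow hp).mp (hX ▸ orderOf_dvd_natCard x)
  have := Fact.mk hp
  rw [h, padicValNat.prime_pow]
  exact ⟨rfl, hs⟩

/-- With truncated subtraction the condition says that the order divides `p ^ c`, so the set is the
kernel of the `p ^ c`-power map. -/
theorem card_padicValNat_orderOf_le {X : Type*} [CommGroup X] [Finite X] [IsCyclic X]
    {p n : ℕ} (hp : p.Prime) (hX : Nat.card X = p ^ n) {c : ℕ}
    (hc : c ≤ n) : Nat.card {x : X // padicValNat p (orderOf x) - c = 0} = p ^ c := by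
  have h1 := IsCyclic.card_powMonoidHom_ker (G := X) (p ^ c)
  rw [hX, Nat.gcd_eq_right (pow_dvd_pow p hc)] at h1
  rw [← h1]
  refine Nat.card_congr (Equiv.subtypeEquivRight fun x => ?_)
  rw [MonoidHom.mem_ker, powMonoidHom_apply, ← orderOf_dvd_iff_pow_eq_one,
    (orderOf_eq_pow_padicValNat hp hX x).1, Nat.pow_dvd_pow_iff_le_right hp.one_lt,
    ← (orderOf_eq_pow_padicValNat hp hX x).1, Nat.sub_eq_zero_iff_le]

theorem card_padicValNat_orderOf_eq {X : Type*} [CommGroup X] [Finite X] [IsCyclic X]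
    {p n : ℕ} (hp : p.Prime) (hX : Nat.card X = p ^ n) {s : ℕ}
    (hs0 : 0 < s) (hs : s ≤ n) :
    Nat.card {x : X // padicValNat p (orderOf x) = s} = p ^ (s - 1) * (p - 1) := by
  have := Fintype.ofFinite X
  have := Fact.mk hp
  have h1 := IsCyclic.card_orderOf_eq_totient (α := X) (d := p ^ s)
    (by rw [← Nat.card_eq_fintype_card, hX]; exact pow_dvd_pow p hs)
  rw [Nat.totient_prime_pow hp hs0] at h1
  rw [← h1, Nat.card_eq_fintype_card, Fintype.card_subtype]
  congr 1
  ext x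
  simp only [Finset.mem_filter, Finset.mem_univ, true_and]
  constructor
  · intro h
    rw [(orderOf_eq_pow_padicValNat hp hX x).1, h]
  · intro h
    rw [h, padicValNat.prime_pow]

/-! ### Orbits and stabilizers -/

section Orbits

variable {G X : Type*} [Group G] [MulAction G X]

/-- The number of orbits on which an invariant function takes a given value, if all of these
orbits have the same length. -/
theorem card_orbits_mul [Finite X] (f : X → ℕ) (hf : ∀ (g : G) x, f (g • x) = f x) (j l : ℕ)
    (hl : ∀ x, f x = j → (MulAction.stabilizer G x).index = l) :
    Nat.card {ω : MulAction.orbitRel.Quotient G X // f (Quotient.out ω) = j} * l =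
      Nat.card {x // f x = j} := by
  let := MulAction.orbitRel G X
  have hout : ∀ x : X, ∃ g : G, g • x =
      Quotient.out (⟦x⟧ : MulAction.orbitRel.Quotient G X) := fun x =>
    MulAction.orbitRel_apply.mp (Quotient.mk_out x)
  have hfo : ∀ x : X, f (Quotient.out (⟦x⟧ : MulAction.orbitRel.Quotient G X)) = f x := by
    intro x
    obtain ⟨g, hg⟩ := hout x
    rw [← hg, hf]
  let π : {x // f x = j} → {ω : MulAction.orbitRel.Quotient G X // f (Quotient.out ω) = j} :=
    fun x => ⟨⟦x.1⟧, (hfo x.1).trans x.2⟩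
  -- The fibre of `π` over an orbit is the orbit itself, whose length is the index of a stabilizer.
  have hfib : ∀ ω, Nat.card {x // π x = ω} = l := by
    rintro ⟨ω, hω⟩
    rw [← hl _ hω, MulAction.index_stabilizer, ← Nat.card_coe_set_eq]
    have hiff : ∀ x : X, (⟦x⟧ : MulAction.orbitRel.Quotient G X) = ω ↔
        x ∈ MulAction.orbit G (Quotient.out ω) := by
      intro x
      rw [← MulAction.orbitRel_apply]
      constructor
      · rintro rfl
        exact Setoid.symm (Quotient.mk_out x)
      · intro h
        rw [← Quotient.out_eq ω]
        exact Quotient.sound h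
    exact Nat.card_congr
      { toFun := fun x => ⟨x.1.1, (hiff _).mp (congrArg Subtype.val x.2)⟩
        invFun := fun x => ⟨⟨x.1, by
          rw [← hfo, (hiff _).mpr x.2, hω]⟩, Subtype.ext ((hiff _).mpr x.2)⟩
        left_inv := fun x => rfl
        right_inv := fun x => rfl }
  have := Fintype.ofFinite {ω : MulAction.orbitRel.Quotient G X // f (Quotient.out ω) = j}
  rw [← Nat.card_congr (Equiv.sigmaFiberEquiv π), Nat.card_sigma]
  simp [hfib]

theorem index_zpowers_pow [Finite G] {σ : G} (hσ : ∀ g : G, g ∈ Subgroup.zpowers σ) {p n m : ℕ}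
    (hp : p.Prime) (hG : Nat.card G = p ^ n) (hm : m ≤ n) :
    (Subgroup.zpowers (σ ^ p ^ m)).index = p ^ m := by
  have hord : orderOf σ = p ^ n := by rw [orderOf_eq_card_of_forall_mem_zpowers hσ, hG]
  have h1 := (Subgroup.zpowers (σ ^ p ^ m)).card_mul_index
  rw [Nat.card_zpowers, orderOf_pow_of_dvd (pow_pos hp.pos m).ne' (hord ▸ pow_dvd_pow p hm),
    hord, hG, Nat.pow_div hm hp.pos] at h1
  refine Nat.eq_of_mul_eq_mul_left (pow_pos hp.pos (n - m)) ?_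
  rw [h1, ← pow_add, Nat.sub_add_cancel hm]

theorem stabilizer_eq_zpowers [Finite G] {σ : G} (hσ : ∀ g : G, g ∈ Subgroup.zpowers σ) {x : X}
    {l : ℕ} (h : ∀ k : ℕ, σ ^ k • x = x ↔ l ∣ k) :
    MulAction.stabilizer G x = Subgroup.zpowers (σ ^ l) := by
  apply le_antisymm
  · intro g hg
    obtain ⟨k, rfl⟩ := (Submonoid.mem_powers_iff _ _).mp (mem_powers_iff_mem_zpowers.mpr (hσ g))
    obtain ⟨u, rfl⟩ := (h k).mp hg
    rw [pow_mul]
    exact Subgroup.npow_mem_zpowers _ _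
  · rw [Subgroup.zpowers_le]
    exact (h l).mpr dvd_rfl

end Orbits

/-! ### The fixed algebra for a cyclic group with a power action -/

/-- The structure of `L[M]^G` if `G = ⟨σ⟩` and `M` are cyclic of order `p ^ n` and `σ` acts on
`M` by `y ↦ y ^ d`, where `d - 1` has valuation `1 + v`. -/
theorem nonempty_fixedPoints_algEquiv_prod {K L M : Type*} [Field K] [Field L] [Algebra K L]
    [FiniteDimensional K L] [IsGalois K L] [CommGroup M] [Finite M] [IsCyclic M] {p n v : ℕ}
    (hp : p.Prime) (hv : 1 + v ≤ n) (hM : Nat.card M = p ^ n)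
    (hK : ∃ ζ : K, IsPrimitiveRoot ζ (p ^ n))
    {σ : Gal(L/K)} (hσ : ∀ g : Gal(L/K), g ∈ Subgroup.zpowers σ) (hG : Nat.card Gal(L/K) = p ^ n)
    (φ : Gal(L/K) →* MulAut M) (d : ℤ) (hφ : ∀ y, φ σ y = y ^ d)
    (hd : ∀ k s : ℕ, s ≤ n → (((p ^ s : ℕ) : ℤ) ∣ d ^ k - 1 ↔ p ^ (s - (1 + v)) ∣ k)) :
    Nonempty (fixedPoints K L φ ≃ₐ[K]
      ((Fin (p ^ (1 + v)) → K) × ((m : Finset.Icc 1 (n - 1 - v)) →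
          (Fin (p ^ v * (p - 1)) → tower p σ (m : ℕ))))) := by
  have : NeZero (p ^ n) := ⟨(pow_pos hp.pos n).ne'⟩
  have hKn : HasEnoughRootsOfUnity K (p ^ n) := ⟨hK, rootsOfUnity.isCyclic K _⟩
  have : HasEnoughRootsOfUnity K (Monoid.exponent M) := by
    rwa [IsCyclic.exponent_eq_card, hM]
  have : HasEnoughRootsOfUnity K (Nat.card M) := by rwa [hM]
  obtain ⟨e⟩ := IsCyclic.monoidHom_equiv_self M K
  have hX : Nat.card (M →* Kˣ) = p ^ n := by rw [Nat.card_congr e.toEquiv, hM]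
  have : Finite (M →* Kˣ) := Finite.of_equiv _ e.symm.toEquiv
  have : IsCyclic (M →* Kˣ) := isCyclic_of_surjective e.symm e.symm.surjective
  let := characterAction (A := Kˣ) φ
  have hsmul : ∀ (g : Gal(L/K)) (χ : M →* Kˣ), g • χ = χ.comp (φ g⁻¹ : M →* M) :=
    fun _ _ => rfl
  have hφk : ∀ (k : ℕ) (y : M), φ (σ ^ k) y = y ^ (d ^ k) := by
    intro k
    induction k with
    | zero => simp
    | succ k ih =>
      intro y
      rw [pow_succ', map_mul, MulAut.mul_apply, ih, map_zpow, hφ, ← zpow_mul, pow_succ']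
  have hstab : ∀ (χ : M →* Kˣ) (k : ℕ), σ ^ k • χ = χ ↔
      p ^ (padicValNat p (orderOf χ) - (1 + v)) ∣ k := by
    intro χ k
    obtain ⟨h1, h2⟩ := orderOf_eq_pow_padicValNat hp hX χ
    have h3 : χ.comp (φ (σ ^ k) : M →* M) = χ ^ (d ^ k) := by
      ext y
      rw [MonoidHom.comp_apply, MonoidHom.coe_coe, hφk, map_zpow, MonoidHom.zpow_apply]
    -- Both sides say `χ ^ (d ^ k) = χ`; the inverse in the action is moved to the other side of the
    -- equation.
    rw [← hd k _ h2, ← h1, orderOf_dvd_iff_zpow_eq_one, zpow_sub_one, mul_inv_eq_one,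
      smul_eq_iff_eq_inv_smul, hsmul, inv_inv, eq_comm, h3]
  have hinv : ∀ (g : Gal(L/K)) (χ : M →* Kˣ), orderOf (g • χ) = orderOf χ := by
    intro g χ
    have h1 : ∀ l : ℕ, (g • χ) ^ l = g • χ ^ l := fun l => by ext y; simp [hsmul]
    have h2 : g • (1 : M →* Kˣ) = 1 := by ext y; simp [hsmul]
    refine orderOf_eq_orderOf_iff.mpr fun l => ?_
    rw [h1, smul_eq_iff_eq_inv_smul, ← h2, inv_smul_smul, h2]
  obtain ⟨e₁⟩ := nonempty_fixedPoints_algEquiv K L M φ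
  -- The orbit of `χ` has length `p ^ lev χ`; truncation gives level `0` to all characters of order
  -- at most `p ^ (1 + v)`, which are the fixed ones.
  let lev : (M →* Kˣ) → ℕ := fun χ => padicValNat p (orderOf χ) - (1 + v)
  have hlev : ∀ χ, lev χ ≤ n - 1 - v := fun χ => by
    have := (orderOf_eq_pow_padicValNat hp hX χ).2
    dsimp only [lev]
    omega
  have hst : ∀ χ, MulAction.stabilizer Gal(L/K) χ = Subgroup.zpowers (σ ^ p ^ lev χ) :=
    fun χ => stabilizer_eq_zpowers hσ (hstab χ)
  -- The number of orbits of level `j`, times `p ^ j`, is the number of characters of level `j`.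
  have hcount : ∀ j, j ≤ n → _ := fun j hj =>
    card_orbits_mul (G := Gal(L/K)) lev (fun g χ => by simp only [lev, hinv]) j (p ^ j)
      fun χ hχ => by rw [hst, hχ, index_zpowers_pow hσ hp hG hj]
  obtain ⟨e₂⟩ := nonempty_equivariantFunctions_algEquiv K L (M →* Kˣ)
    (fun ω => tower p σ (lev (Quotient.out ω))) (fun ω => by rw [hst])
  obtain ⟨e₃⟩ := nonempty_pi_algEquiv_sorted (K := K) (L := L) (tower p σ)
    (by
      rw [tower, pow_zero, pow_one, (Subgroup.eq_top_iff' _).mpr hσ]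
      exact IsGalois.fixedField_top)
    (fun ω : MulAction.orbitRel.Quotient Gal(L/K) (M →* Kˣ) => lev (Quotient.out ω))
    (T := n - 1 - v) (A := p ^ (1 + v)) (B := p ^ v * (p - 1)) (fun ω => hlev _)
    (by
      have h := hcount 0 (Nat.zero_le n)
      rwa [pow_zero, mul_one, card_padicValNat_orderOf_le hp hX hv] at h)
    (by
      intro j hj1 hj
      have h := hcount j (by omega)
      have h2 : Nat.card {χ // lev χ = j} =
          Nat.card {χ : M →* Kˣ // padicValNat p (orderOf χ) = 1 + v + j} :=
        Nat.card_congr (Equiv.subtypeEquivRight fun χ => by dsimp only [lev]; omega)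
      rw [h2, card_padicValNat_orderOf_eq hp hX (by omega) (by omega)] at h
      refine Nat.eq_of_mul_eq_mul_right (pow_pos hp.pos j) (h.trans ?_)
      rw [show 1 + v + j - 1 = v + j by omega, pow_add]
      ring)
  exact ⟨(e₁.trans e₂).trans e₃⟩

/-! ### The valuation of `d - 1` -/

/-- Lifting the exponent for odd `p`: `d ^ k - 1` and `(d - 1) * k` have the same, possibly
infinite, `p`-adic valuation. -/
theorem pow_dvd_pow_sub_one_iff {p : ℕ} (hp : p.Prime) (hp2 : p ≠ 2) {d : ℤ}
    (hd : (p : ℤ) ∣ d - 1) (s k : ℕ) :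
    ((p ^ s : ℕ) : ℤ) ∣ d ^ k - 1 ↔ ((p ^ s : ℕ) : ℤ) ∣ (d - 1) * k := by
  have hpd : ¬ (p : ℤ) ∣ d := fun h => by
    have h3 : (p : ℤ) ∣ 1 := by simpa using dvd_sub h hd
    have h4 : p ∣ 1 := by exact_mod_cast h3
    exact hp.one_lt.ne' (Nat.dvd_one.mp h4)
  have h2 := Int.emultiplicity_pow_sub_pow hp (hp.odd_of_ne_two hp2) hd hpd k
  rw [one_pow] at h2
  rw [Nat.cast_pow, pow_dvd_iff_le_emultiplicity, pow_dvd_iff_le_emultiplicity, h2,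
    emultiplicity_mul (Nat.prime_iff_prime_int.mp hp), Int.natCast_emultiplicity]

theorem pow_dvd_pow_mul_iff {p : ℕ} (hp : p.Prime) {c s k : ℕ} {u : ℤ} (hu : ¬ (p : ℤ) ∣ u) :
    ((p ^ s : ℕ) : ℤ) ∣ ((p ^ c : ℕ) : ℤ) * u * k ↔ p ^ (s - c) ∣ k := by
  have hcop : IsCoprime ((p ^ s : ℕ) : ℤ) u := by
    rw [Nat.cast_pow]
    exact ((Nat.prime_iff_prime_int.mp hp).coprime_iff_not_dvd.mpr hu).pow_left
  rw [mul_right_comm, show ((p ^ s : ℕ) : ℤ) ∣ ((p ^ c : ℕ) : ℤ) * k * u ↔ _ from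
    ⟨hcop.dvd_of_dvd_mul_right, fun h => h.mul_right u⟩, ← Nat.cast_mul, Int.natCast_dvd_natCast]
  rcases le_total s c with h | h
  · simp [Nat.sub_eq_zero_of_le h, (pow_dvd_pow p h).mul_right k]
  · obtain ⟨t, rfl⟩ := Nat.exists_eq_add_of_le h
    rw [pow_add, Nat.mul_dvd_mul_iff_left (pow_pos hp.pos c), Nat.add_sub_cancel_left]

theorem val_lt {p n r : ℕ} (hp : p.Prime) (hn : 1 ≤ n) (hr : r < p ^ (n - 1)) :
    1 + val p n r ≤ n := by
  rw [val]
  split_ifs with h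
  · omega
  · have := Fact.mk hp
    have h1 := (Nat.pow_lt_pow_iff_right hp.one_lt).mp
      ((Nat.le_of_dvd (Nat.pos_of_ne_zero h) pow_padicValNat_dvd).trans_lt hr)
    omega

/-- If `θ` generates `Aut N` and `(θ ^ (p - 1)) ^ r` is `η ↦ η ^ d`, then `d - 1` has valuation
`1 + v_p(r)` as far as can be seen modulo `p ^ n`. -/
theorem pow_dvd_pow_sub_one_iff_of_generator {N : Type*} [Group N] {p n : ℕ} (hp : p.Prime)
    (hp2 : p ≠ 2) (hn : 1 ≤ n) {η : N} (hη : ∀ x : N, x ∈ Subgroup.zpowers η)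
    (hN : Nat.card N = p ^ n) {θ : MulAut N} (hθ : ∀ φ : MulAut N, φ ∈ Subgroup.zpowers θ)
    {r : ℕ} (hr : r < p ^ (n - 1)) {d : ℤ} (hd1 : (p : ℤ) ∣ d - 1)
    (hd2 : ((θ ^ (p - 1)) ^ r) η = η ^ d) (k s : ℕ) (hs : s ≤ n) :
    ((p ^ s : ℕ) : ℤ) ∣ d ^ k - 1 ↔ p ^ (s - (1 + val p n r)) ∣ k := by
  have := Fact.mk hp
  have hcyc : IsCyclic N := ⟨η, hη⟩
  have : Finite N := Nat.finite_of_card_ne_zero (hN ▸ (pow_pos hp.pos n).ne')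
  have hordη : orderOf η = p ^ n := by rw [orderOf_eq_card_of_forall_mem_zpowers hη, hN]
  have hordθ : orderOf θ = p ^ (n - 1) * (p - 1) := by
    rw [orderOf_eq_card_of_forall_mem_zpowers hθ, IsCyclic.card_mulAut, hN,
      Nat.totient_prime_pow hp hn]
  have hpow : ∀ j : ℕ, (((θ ^ (p - 1)) ^ r) ^ j) η = η ^ (d ^ j) := by
    intro j
    induction j with
    | zero => simp
    | succ j ih => rw [pow_succ', MulAut.mul_apply, ih, map_zpow, hd2, ← zpow_mul, pow_succ']
  have hext : ∀ ψ : MulAut N, ψ = 1 ↔ ψ η = η := by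
    refine fun ψ => ⟨fun h => by rw [h, MulAut.one_apply], fun h => ?_⟩
    ext x
    obtain ⟨a, rfl⟩ := Subgroup.mem_zpowers_iff.mp (hη x)
    rw [map_zpow, h, MulAut.one_apply]
  -- Both sides say `(δ ^ r) ^ j = 1`: on the left through its effect on `η`, on the right because
  -- `θ` has order `p ^ (n - 1) * (p - 1)`.
  have key : ∀ j : ℕ, ((p ^ n : ℕ) : ℤ) ∣ (d - 1) * j ↔ p ^ (n - 1) ∣ r * j := by
    intro j
    rw [← pow_dvd_pow_sub_one_iff hp hp2 hd1, ← hordη, orderOf_dvd_iff_zpow_eq_one, zpow_sub_one,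
      mul_inv_eq_one, ← hpow, ← hext, ← pow_mul, ← pow_mul, ← orderOf_dvd_iff_pow_eq_one, hordθ,
      mul_comm, Nat.mul_dvd_mul_iff_left (Nat.sub_pos_of_lt hp.one_lt)]
  rw [pow_dvd_pow_sub_one_iff hp hp2 hd1]
  -- For `r = 0` one has `d ≡ 1` mod `p ^ n`, and the convention `val = n - 1` makes the exponent `s
  -- - n = 0`.
  by_cases h0 : r = 0
  · have h1 := (key 1).mpr (by simp [h0])
    rw [Nat.cast_one, mul_one] at h1
    have h2 : s - (1 + val p n r) = 0 := by rw [val, if_pos h0]; omega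
    rw [h2, pow_zero]
    exact iff_of_true (((Int.natCast_dvd_natCast.mpr (pow_dvd_pow p hs)).trans h1).mul_right _)
      (one_dvd _)
  · have hv := val_lt hp hn hr
    rw [val, if_neg h0] at hv ⊢
    obtain ⟨w, hw⟩ := pow_padicValNat_dvd (p := p) (n := r)
    have hpw : ¬ p ∣ w := by
      intro ⟨t, ht⟩
      apply pow_succ_padicValNat_not_dvd (p := p) h0
      exact ⟨t, by rw [pow_succ, mul_assoc, ← ht, ← hw]⟩
    generalize padicValNat p r = v at *
    have hvr : v < n - 1 := (Nat.pow_lt_pow_iff_right hp.one_lt).mp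
      ((Nat.le_of_dvd (Nat.pos_of_ne_zero h0) ⟨w, hw⟩).trans_lt hr)
    obtain ⟨t, rfl⟩ : ∃ t, n = v + t + 2 := ⟨n - 2 - v, by omega⟩
    rw [show v + t + 2 - 1 = v + (t + 1) by omega] at key
    -- Take `j = p ^ (t + 1)`: then `p ^ (n - 1)` divides `r * j`, so `p ^ n` divides `(d - 1) * j`.
    have hdvd : ((p ^ (1 + v) : ℕ) : ℤ) ∣ d - 1 := by
      have h1 := (key (p ^ (t + 1))).mpr
        ⟨w, by rw [hw]; ring⟩
      rw [show v + t + 2 = 1 + v + (t + 1) by omega, pow_add, Nat.cast_mul] at h1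
      exact Int.dvd_of_mul_dvd_mul_right
        (by exact_mod_cast (pow_pos hp.pos (t + 1)).ne') h1
    obtain ⟨u, hu⟩ := hdvd
    -- Take `j = p ^ t`: if `p ∣ u`, then `p ^ n` divides `(d - 1) * j`, so `p ^ (n - 1)` divides `r
    -- * j`, which forces `p ∣ w`.
    have hpu : ¬ (p : ℤ) ∣ u := by
      rintro ⟨u', rfl⟩
      have h1 := (key (p ^ t)).mp ⟨u', by rw [hu]; push_cast; ring⟩
      rw [hw, pow_add, pow_succ, mul_assoc, Nat.mul_dvd_mul_iff_left (pow_pos hp.pos v),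
        mul_comm w, Nat.mul_dvd_mul_iff_left (pow_pos hp.pos t)] at h1
      exact hpw h1
    rw [hu]
    exact pow_dvd_pow_mul_iff hp hpu

/-! ### The conjugation action and the main theorem -/

/-- The conjugation action of `G` on `α(N)` corresponds to the action on `N` through the
automorphism part of `β`. -/
theorem lam_mul_translate_mul_inv {G N : Type*} [Group G] [Group N] (β : G →* Hol N)
    (hβ : Function.Bijective fun g : G => (β g : Equiv.Perm N) 1) {g : G} {y : N} {ψ : MulAut N}
    (hg : β g = holElt y ψ) (x : N) :
    lam G g * translate β hβ x * (lam G g)⁻¹ = translate β hβ (ψ x) := by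
  rw [mul_inv_eq_iff_eq_mul]
  -- Under `b`, left translation by `g` becomes the permutation `β g`.
  have h2 : ∀ h : G, orbitEquiv β hβ (g * h) = ψ (orbitEquiv β hβ h) * y⁻¹ := by
    intro h
    rw [← holElt_apply, ← hg]
    simp [orbitEquiv]
  ext h
  apply (orbitEquiv β hβ).injective
  simp [lam, translate, Equiv.permCongrHom, Equiv.permCongr_apply, h2, mul_assoc]

theorem translate_injective {G N : Type*} [Group G] [Group N] (β : G →* Hol N)
    (hβ : Function.Bijective fun g : G => (β g : Equiv.Perm N) 1) :
    Function.Injective (translate β hβ) := by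
  refine (orbitEquiv β hβ).symm.permCongrHom.injective.comp fun a b h => ?_
  simpa [lam] using DFunLike.congr_fun h 1

end CyclicHopfGalois

theorem mainTheorem10 {K L N : Type*} [Field K] [CharZero K] [Field L] [Algebra K L]
    [FiniteDimensional K L] [IsGalois K L] [Group N]
    {p n : ℕ} (hp : p.Prime) (hp2 : p ≠ 2) (hn : 1 ≤ n)
    (hL : Module.finrank K L = p ^ n)
    (hK : ∃ ζ : K, IsPrimitiveRoot ζ (p ^ n))
    {σ : Gal(L/K)} (hσ : ∀ g : Gal(L/K), g ∈ Subgroup.zpowers σ)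
    {η : N} (hη : ∀ x : N, x ∈ Subgroup.zpowers η) (hN : Nat.card N = p ^ n)
    {θ : MulAut N} (hθ : ∀ φ : MulAut N, φ ∈ Subgroup.zpowers θ)
    {r : ℕ} (hr : r < p ^ (n - 1)) :
    Nonempty
      (CyclicHopfGalois.hopfAlgCyclic K L hp hp2 hn hσ ((IsGalois.card_aut_eq_finrank K L).trans hL) hη hN θ r
        ≃ₐ[K]
      ((Fin (p ^ (1 + CyclicHopfGalois.val p n r)) → K) ×
        ((m : Finset.Icc 1 (n - 1 - CyclicHopfGalois.val p n r)) →
          (Fin (p ^ CyclicHopfGalois.val p n r * (p - 1)) → CyclicHopfGalois.tower p σ (m : ℕ))))) := by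
  open CyclicHopfGalois in
  have hG := (IsGalois.card_aut_eq_finrank K L).trans hL
  obtain ⟨d, hd1, hd2⟩ := aut_pow_gen hp hn hη hN θ r
  have : Finite N := Nat.finite_of_card_ne_zero (hN ▸ (pow_pos hp.pos n).ne')
  have hcyc : IsCyclic N := ⟨η, hη⟩
  let β := beta hp hp2 hn hσ hG hη hN θ r
  have hβ := beta_regular hp hp2 hn hσ hG hη hN θ r
  let M := (alpha hp hp2 hn hσ hG hη hN θ r).range
  let e : N ≃* M := MonoidHom.ofInjective (translate_injective β hβ)
  have : Finite M := Finite.of_equiv _ e.toEquiv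
  have : IsCyclic M := isCyclic_of_surjective e e.surjective
  have hM : Nat.card M = p ^ n := by rw [← Nat.card_congr e.toEquiv, hN]
  -- The Fourier transform argument needs `M` as a commutative group; this structure extends the one
  -- it has as a subgroup of `Perm G`.
  let : CommGroup M := IsCyclic.commGroup
  have hψ : ∀ x : N, ((θ ^ (p - 1)) ^ r) x = x ^ d := by
    intro x
    obtain ⟨a, rfl⟩ := Subgroup.mem_zpowers_iff.mp (hη x)
    rw [map_zpow, hd2, ← zpow_mul, ← zpow_mul, mul_comm]
  refine nonempty_fixedPoints_algEquiv_prod (M := M) hp (val_lt hp hn hr) hM hK hσ hG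
    (conjAct M (translate_stable β hβ)) d (fun y => ?_)
    (pow_dvd_pow_sub_one_iff_of_generator hp hp2 hn hη hN hθ hr hd1 hd2)
  obtain ⟨x, rfl⟩ := e.surjective y
  refine Subtype.ext ((lam_mul_translate_mul_inv β hβ
    (beta_gen hp hp2 hn hσ hG hη hN θ r) x).trans ?_)
  rw [hψ, map_zpow]
  rfl
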